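/- Let $k$ be a commutative ring and let $H$ be a Hopf $k$-algebra with comultiplication $\Delta$, counit $\varepsilon$ and antipode $S$. Assume that $H$ is involutory, i.e. $S^2=\mathrm{id}_H$, and that $H$ is a Frobenius $k$-algebra, i.e. $H$ is finitely generated projective over $k$ and isomorphic as a left $H$-module to $H^*=\operatorname{Hom}_k(H,k)$, where $(af)(x)=f(xa)$. Let $$\mathfrak{d}H=\varepsilon\big(\{a\in H : ba=\varepsilon(b)a \text{ for all } b\in H\}\big),$$ the ideal of $k$ formed by the values of $\varepsilon$ on the left integrals of $H$ (the right integrals give the same ideal). Let $B$ be a right $H$-comodule algebra with coaction $\rho\colon B\to B\otimes_k H$, let $A=B^{\mathrm{co}\,H}=\{a\in B:\rho(a)=a\otimes 1\}$ with inclusion $\iota\colon A\hookrightarrow B$, and assume that $B/A$ is $H$-Galois: at least one of the maps $B\otimes_A B\to B\otimes_k H$ given by $b\otimes b'\mapsto (b\otimes 1)\rho(b')$ and by $b\otimes b'\mapsto\rho(b)(b'\otimes 1)$ is bijective. For a ring $R$ let $[R,R]$ be the additive subgroup generated by all $xy-yx$ with $x,y\in R$, let $T(R)=R/[R,R]$,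 let $K_0(R)$ be the Grothendieck group of finitely generated projective left $R$-modules, and let $r_R\colon K_0(R)\to T(R)$ be the Hattori–Stallings rank: $r_R([P])=\sum_i \big(f_i(p_i)+[R,R]\big)$ for any finite dual bases $f_i\in\operatorname{Hom}_R(P,R)$, $p_i\in P$, that is, $x=\sum_i f_i(x)p_i$ for all $x\in P$. Then $B$ is finitely generated and projective as a left $A$-module, so that restriction $\operatorname{Res}^B_A\colon K_0(B)\to K_0(A)$, $[P]\mapsto[{}_AP]$, is defined, and the image of the composite $$T(\iota)\circ r_A\circ \operatorname{Res}^B_A\colon K_0(B)\to K_0(A)\to T(A)\to T(B)$$ is contained in $\big((\mathfrak{d}H)A+[B,B]\big)/[B,B]$. -/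

import Mathlib

open scoped TensorProduct

universe u v w

noncomputable section

/-! ### Lie commutators and Hattori–Stallings ranks -/

/-- The additive subgroup `[R, R]` generated by the Lie commutators `x * y - y * x`. -/
def lieCommutators (R : Type u) [Ring R] : AddSubgroup R :=
  AddSubgroup.closure {z | ∃ x y : R, z = x * y - y * x}

/-- `T(R) = R / [R, R]`. -/
abbrev TraceGroup (R : Type u) [Ring R] : Type u := R ⧸ lieCommutators R

namespace TraceGroup

/-- The canonical epimorphism `R → T(R)`. -/
def mk (R : Type u) [Ring R] : R →+ TraceGroup R := QuotientAddGroup.mk' (lieCommutators R)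

theorem mk_mul_comm {R : Type u} [Ring R] (x y : R) : mk R (x * y) = mk R (y * x) := by
  rw [← sub_eq_zero, ← map_sub]
  exact (QuotientAddGroup.eq_zero_iff _).2 (AddSubgroup.subset_closure ⟨x, y, rfl⟩)

/-- Functoriality: `T(f) : T(R) → T(S)`, `a + [R, R] ↦ f a + [S, S]`. -/
def map {R : Type u} {S : Type v} [Ring R] [Ring S] (f : R →+* S) :
    TraceGroup R →+ TraceGroup S :=
  QuotientAddGroup.map (lieCommutators R) (lieCommutators S) f.toAddMonoidHom (by
    rw [lieCommutators, AddSubgroup.closure_le]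
    rintro _ ⟨x, y, rfl⟩
    exact AddSubgroup.subset_closure ⟨f x, f y, by simp⟩)

end TraceGroup

/-- `f`, `p` are dual bases of the left `R`-module `P`: `x = ∑ i, f i x • p i` for all `x`. -/
def IsDualBases {R : Type u} {P : Type v} [Ring R] [AddCommGroup P] [Module R P]
    {ι : Type*} [Fintype ι] (f : ι → P →ₗ[R] R) (p : ι → P) : Prop :=
  ∀ x : P, x = ∑ i, f i x • p i

theorem exists_isDualBases (R : Type u) (P : Type v) [Ring R] [AddCommGroup P] [Module R P]
    [Module.Finite R P] [Module.Projective R P] :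
    ∃ (n : ℕ) (f : Fin n → P →ₗ[R] R) (p : Fin n → P), IsDualBases f p := by
  obtain ⟨n, π, σ, -, -, h⟩ := Module.Finite.exists_comp_eq_id_of_projective R P
  refine ⟨n, fun i => (LinearMap.proj i).comp σ, fun i => π (Pi.single i 1), fun x => ?_⟩
  have h1 : π (σ x) = x := LinearMap.congr_fun h x
  conv_lhs => rw [← h1, pi_eq_sum_univ' (σ x), map_sum]
  refine Finset.sum_congr rfl fun i _ => ?_
  rw [map_smul]
  congr 2

/-- The trace `Tr_{P/R}(φ) = ∑ i, T(f i (φ (p i))) ∈ T(R)` of an endomorphism `φ` of a finitely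
generated projective left `R`-module `P`, computed from some dual bases `f`, `p` of `P`
(by `hattoriTrace_eq` the choice is immaterial). -/
def hattoriTrace (R : Type u) (P : Type v) [Ring R] [AddCommGroup P] [Module R P]
    [Module.Finite R P] [Module.Projective R P] (φ : P →ₗ[R] P) : TraceGroup R :=
  ∑ i, TraceGroup.mk R ((exists_isDualBases R P).choose_spec.choose i
    (φ ((exists_isDualBases R P).choose_spec.choose_spec.choose i)))

theorem IsDualBases.sum_eq {R : Type u} {P : Type v} [Ring R] [AddCommGroup P] [Module R P]
    {ι κ : Type*} [Fintype ι] [Fintype κ] {f : ι → P →ₗ[R] R} {p : ι → P}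
    {g : κ → P →ₗ[R] R} {q : κ → P} (h : IsDualBases f p) (h' : IsDualBases g q)
    (φ : P →ₗ[R] P) :
    ∑ i, TraceGroup.mk R (f i (φ (p i))) = ∑ j, TraceGroup.mk R (g j (φ (q j))) := by
  have h1 : ∀ i, TraceGroup.mk R (f i (φ (p i))) =
      ∑ j, TraceGroup.mk R (f i (φ (q j)) * g j (p i)) := fun i => by
    conv_lhs => rw [h' (p i)]
    simp only [map_sum, map_smul, smul_eq_mul]
    exact Finset.sum_congr rfl fun j _ => TraceGroup.mk_mul_comm _ _
  have h2 : ∀ j, TraceGroup.mk R (g j (φ (q j))) =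
      ∑ i, TraceGroup.mk R (f i (φ (q j)) * g j (p i)) := fun j => by
    conv_lhs => rw [h (φ (q j))]
    simp only [map_sum, map_smul, smul_eq_mul]
  simp only [h1, h2]
  exact Finset.sum_comm

theorem hattoriTrace_eq {R : Type u} {P : Type v} [Ring R] [AddCommGroup P] [Module R P]
    [Module.Finite R P] [Module.Projective R P] {ι : Type*} [Fintype ι]
    {f : ι → P →ₗ[R] R} {p : ι → P} (h : IsDualBases f p) (φ : P →ₗ[R] P) :
    hattoriTrace R P φ = ∑ i, TraceGroup.mk R (f i (φ (p i))) :=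
  (exists_isDualBases R P).choose_spec.choose_spec.choose_spec.sum_eq h φ

/-- The Hattori–Stallings rank `r_R(P) = Tr_{P/R}(1_P)`. -/
def hattoriRank (R : Type u) (P : Type v) [Ring R] [AddCommGroup P] [Module R P]
    [Module.Finite R P] [Module.Projective R P] : TraceGroup R :=
  hattoriTrace R P LinearMap.id

theorem hattoriRank_congr {R : Type u} {P : Type v} {Q : Type w} [Ring R]
    [AddCommGroup P] [Module R P] [Module.Finite R P] [Module.Projective R P]
    [AddCommGroup Q] [Module R Q] [Module.Finite R Q] [Module.Projective R Q]
    (e : P ≃ₗ[R] Q) : hattoriRank R P = hattoriRank R Q := by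
  obtain ⟨n, f, p, h⟩ := exists_isDualBases R P
  have h' : IsDualBases (fun i => (f i).comp e.symm.toLinearMap) (fun i => e (p i)) := by
    intro x
    have := congrArg e (h (e.symm x))
    simpa using this
  rw [hattoriRank, hattoriRank, hattoriTrace_eq h, hattoriTrace_eq h']
  simp

theorem hattoriRank_prod (R : Type u) (P : Type v) (Q : Type w) [Ring R]
    [AddCommGroup P] [Module R P] [Module.Finite R P] [Module.Projective R P]
    [AddCommGroup Q] [Module R Q] [Module.Finite R Q] [Module.Projective R Q] :
    hattoriRank R (P × Q) = hattoriRank R P + hattoriRank R Q := by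
  obtain ⟨n, f, p, h⟩ := exists_isDualBases R P
  obtain ⟨m, g, q, h'⟩ := exists_isDualBases R Q
  have H : IsDualBases
      (Sum.elim (fun i => (f i).comp (LinearMap.fst R P Q))
        (fun j => (g j).comp (LinearMap.snd R P Q)))
      (Sum.elim (fun i => (p i, (0 : Q))) (fun j => ((0 : P), q j))) := by
    rintro ⟨x, y⟩
    rw [Fintype.sum_sum_type]
    simp only [Sum.elim_inl, Sum.elim_inr, LinearMap.comp_apply, LinearMap.fst_apply,
      LinearMap.snd_apply]
    ext
    · simpa [Prod.fst_sum] using h x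
    · simpa [Prod.snd_sum] using h' y
  rw [hattoriRank, hattoriRank, hattoriRank, hattoriTrace_eq h, hattoriTrace_eq h',
    hattoriTrace_eq H, Fintype.sum_sum_type]
  simp

/-! ### The Grothendieck group `K₀` -/

/-- Finitely generated projective left `R`-modules. -/
structure FGProj (R : Type u) [Ring R] : Type (u + 1) where
  carrier : Type u
  [addCommGroup : AddCommGroup carrier]
  [module : Module R carrier]
  [finite : Module.Finite R carrier]
  [projective : Module.Projective R carrier]

attribute [instance] FGProj.addCommGroup FGProj.module FGProj.finite FGProj.projective

/-- Isomorphism of finitely generated projective modules. -/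
instance FGProj.setoid (R : Type u) [Ring R] : Setoid (FGProj R) where
  r P Q := Nonempty (P.carrier ≃ₗ[R] Q.carrier)
  iseqv :=
    { refl := fun _ => ⟨LinearEquiv.refl _ _⟩
      symm := fun ⟨e⟩ => ⟨e.symm⟩
      trans := fun ⟨e⟩ ⟨e'⟩ => ⟨e.trans e'⟩ }

/-- Isomorphism classes of finitely generated projective left `R`-modules. -/
def FGProjClass (R : Type u) [Ring R] : Type (u + 1) := Quotient (FGProj.setoid R)

namespace FGProjClass

/-- The isomorphism class of a finitely generated projective module. -/
def mk {R : Type u} [Ring R] (P : FGProj R) : FGProjClass R := Quotient.mk _ P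

/-- The class of the zero module. -/
instance instZero (R : Type u) [Ring R] : Zero (FGProjClass R) where
  zero := mk (FGProj.mk PUnit)

/-- Addition of isomorphism classes is induced by the direct sum. -/
instance instAdd (R : Type u) [Ring R] : Add (FGProjClass R) where
  add := Quotient.map₂ (fun P Q => FGProj.mk (P.carrier × Q.carrier))
    fun _ _ ⟨e⟩ _ _ ⟨e'⟩ => ⟨LinearEquiv.prodCongr e e'⟩

instance instAddCommMonoid (R : Type u) [Ring R] : AddCommMonoid (FGProjClass R) where
  add_assoc := by
    rintro ⟨P⟩ ⟨Q⟩ ⟨S⟩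
    exact Quotient.sound ⟨LinearEquiv.prodAssoc R P.carrier Q.carrier S.carrier⟩
  zero_add := by
    rintro ⟨P⟩
    exact Quotient.sound ⟨LinearEquiv.uniqueProd⟩
  add_zero := by
    rintro ⟨P⟩
    exact Quotient.sound ⟨LinearEquiv.prodUnique⟩
  add_comm := by
    rintro ⟨P⟩ ⟨Q⟩
    exact Quotient.sound ⟨LinearEquiv.prodComm R P.carrier Q.carrier⟩
  nsmul := nsmulRec

end FGProjClass

/-- `K₀(R)`: the Grothendieck group of the monoid of isomorphism classes of finitely generated
projective left `R`-modules. -/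
abbrev K0 (R : Type u) [Ring R] : Type (u + 1) := Algebra.GrothendieckAddGroup (FGProjClass R)

namespace K0

/-- The class `[P] ∈ K₀(R)`. -/
def cls {R : Type u} [Ring R] (P : FGProj R) : K0 R :=
  Algebra.GrothendieckAddGroup.of (FGProjClass.mk P)

/-- The Hattori–Stallings rank `r_R : K₀(R) → T(R)`, `[P] ↦ r_R(P)`. -/
def rank (R : Type u) [Ring R] : K0 R →+ TraceGroup R :=
  Algebra.GrothendieckAddGroup.lift
    { toFun := Quotient.lift (fun P : FGProj R => hattoriRank R P.carrier)
        fun _ _ ⟨e⟩ => hattoriRank_congr e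
      map_zero' := by
        have h : IsDualBases (fun i : Fin 0 => (0 : PUnit.{u + 1} →ₗ[R] R)) (fun _ => 0) :=
          fun _ => rfl
        exact (hattoriTrace_eq h _).trans (by simp)
      map_add' := by
        rintro ⟨P⟩ ⟨Q⟩
        exact hattoriRank_prod R P.carrier Q.carrier }

theorem rank_cls {R : Type u} [Ring R] (P : FGProj R) :
    rank R (cls P) = hattoriRank R P.carrier :=
  DFunLike.congr_fun (Algebra.GrothendieckAddGroup.lift.symm_apply_apply _)
    (FGProjClass.mk P)

end K0

/-- If `B` is a finitely generated projective left module over a subalgebra `A`, then so is every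
finitely generated projective left `B`-module. -/
theorem finite_projective_restrict {k : Type v} {B : Type u} [CommRing k] [Ring B] [Algebra k B]
    (A : Subalgebra k B) [Module.Finite A B] [Module.Projective A B]
    (P : Type w) [AddCommGroup P] [Module B P] [Module.Finite B P] [Module.Projective B P] :
    Module.Finite A P ∧ Module.Projective A P := by
  obtain ⟨n, π, σ, -, -, h⟩ := Module.Finite.exists_comp_eq_id_of_projective B P
  have h' : (π.restrictScalars A).comp (σ.restrictScalars A) = LinearMap.id := by
    ext x
    exact LinearMap.congr_fun h x
  have : Module.Projective A (Fin n → B) :=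
    Module.Projective.of_equiv' (DFinsupp.linearEquivFunOnFintype (R := A) (M := fun _ : Fin n => B))
  refine ⟨Module.Finite.of_surjective (π.restrictScalars A) fun x => ⟨σ x, ?_⟩,
    Module.Projective.of_split _ _ h'⟩
  exact LinearMap.congr_fun h x

/-- Restriction of a finitely generated projective module to a subalgebra. -/
def FGProj.res {k : Type v} {B : Type u} [CommRing k] [Ring B] [Algebra k B]
    (A : Subalgebra k B) [Module.Finite A B] [Module.Projective A B] (P : FGProj B) : FGProj A :=
  haveI := (finite_projective_restrict A P.carrier).1
  haveI := (finite_projective_restrict A P.carrier).2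
  FGProj.mk P.carrier

/-- The restriction map `Res : K₀(B) → K₀(A)`, `[P] ↦ [_A P]`, for a subalgebra `A` of `B` such
that `B` is finitely generated and projective as a left `A`-module. -/
def K0.res {k : Type v} {B : Type u} [CommRing k] [Ring B] [Algebra k B]
    (A : Subalgebra k B) [Module.Finite A B] [Module.Projective A B] : K0 B →+ K0 A :=
  Algebra.GrothendieckAddGroup.lift
    { toFun := Quotient.lift (fun P : FGProj B => K0.cls (P.res A))
        fun _ _ ⟨e⟩ => congrArg Algebra.GrothendieckAddGroup.of
          (Quotient.sound ⟨(LinearEquiv.restrictScalars A e :)⟩)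
      map_zero' := by
        rw [← map_zero (Algebra.GrothendieckAddGroup.of (M := FGProjClass A))]
        exact congrArg Algebra.GrothendieckAddGroup.of
          (Quotient.sound ⟨(LinearEquiv.refl A PUnit.{u + 1} :)⟩)
      map_add' := by
        rintro ⟨P⟩ ⟨Q⟩
        refine Eq.trans ?_ (map_add (Algebra.GrothendieckAddGroup.of (M := FGProjClass A)) _ _)
        exact congrArg Algebra.GrothendieckAddGroup.of
          (Quotient.sound ⟨(LinearEquiv.refl A (P.carrier × Q.carrier) :)⟩) }

theorem K0.res_cls {k : Type v} {B : Type u} [CommRing k] [Ring B] [Algebra k B]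
    (A : Subalgebra k B) [Module.Finite A B] [Module.Projective A B] (P : FGProj B) :
    K0.res A (K0.cls P) = K0.cls (P.res A) :=
  DFunLike.congr_fun (Algebra.GrothendieckAddGroup.lift.symm_apply_apply _)
    (FGProjClass.mk P)

/-! ### Frobenius algebras, Hopf algebras and integrals -/

/-- A `k`-algebra `H` is Frobenius if it is finitely generated projective over `k` and isomorphic,
as a left `H`-module, to its dual `H*` with the action `(a f)(x) = f (x a)`. -/
def IsFrobeniusAlgebra (k : Type v) (H : Type w) [CommRing k] [Ring H] [Algebra k H] : Prop :=
  Module.Finite k H ∧ Module.Projective k H ∧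
    ∃ e : H ≃ₗ[k] Module.Dual k H, ∀ a b x : H, e (a * b) x = e b (x * a)

section Hopf

variable (k : Type v) (H : Type w) [CommRing k] [Ring H] [HopfAlgebra k H]

/-- A Hopf algebra is involutory if its antipode squares to the identity. -/
def IsInvolutory : Prop :=
  ∀ h : H, HopfAlgebra.antipode k (HopfAlgebra.antipode k h) = h

/-- The left integrals `{a | b a = ε(b) a for all b}`. -/
def leftIntegrals : Submodule k H where
  carrier := {a | ∀ b : H, b * a = Coalgebra.counit (R := k) b • a}
  add_mem' ha hb c := by rw [mul_add, ha c, hb c, smul_add]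
  zero_mem' c := by simp
  smul_mem' r a ha c := by rw [mul_smul_comm, ha c, smul_comm]

/-- The right integrals `{a | a b = ε(b) a for all b}`. -/
def rightIntegrals : Submodule k H where
  carrier := {a | ∀ b : H, a * b = Coalgebra.counit (R := k) b • a}
  add_mem' ha hb c := by rw [add_mul, ha c, hb c, smul_add]
  zero_mem' c := by simp
  smul_mem' r a ha c := by rw [smul_mul_assoc, ha c, smul_comm]

/-- The ideal `𝔡H = ε(∫ˡ)` of `k`. -/
def integralIdeal : Ideal k := (leftIntegrals k H).map (Coalgebra.counit (R := k) (A := H))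

/-- Right integrals define the same ideal. -/
theorem integralIdeal_eq_map_rightIntegrals (hH : IsInvolutory k H) :
    integralIdeal k H = (rightIntegrals k H).map (Coalgebra.counit (R := k) (A := H)) := by
  apply le_antisymm
  · rintro _ ⟨a, ha, rfl⟩
    refine ⟨HopfAlgebra.antipode k a, fun b => ?_, HopfAlgebra.counit_antipode a⟩
    rw [← hH b, ← HopfAlgebra.antipode_mul_antidistrib, ha, map_smul, hH,
      HopfAlgebra.counit_antipode]
  · rintro _ ⟨a, ha, rfl⟩
    refine ⟨HopfAlgebra.antipode k a, fun b => ?_, HopfAlgebra.counit_antipode a⟩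
    rw [← hH b, ← HopfAlgebra.antipode_mul_antidistrib, ha, map_smul, hH,
      HopfAlgebra.counit_antipode]

end Hopf

/-! ### Comodule algebras and Hopf–Galois extensions -/

/-- A right `H`-comodule algebra structure on the `k`-algebra `B`: a coassociative and counital
coaction `ρ : B → B ⊗ H` that is a homomorphism of `k`-algebras. -/
structure RightComoduleAlgebra (k : Type v) (H : Type w) (B : Type u) [CommRing k] [Ring H]
    [HopfAlgebra k H] [Ring B] [Algebra k B] where
  /-- the coaction -/
  coact : B →ₐ[k] B ⊗[k] H
  coassoc : (TensorProduct.assoc k B H H).toLinearMap ∘ₗ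
      coact.toLinearMap.rTensor H ∘ₗ coact.toLinearMap =
    (Coalgebra.comul (R := k) (A := H)).lTensor B ∘ₗ coact.toLinearMap
  counit : (TensorProduct.rid k B).toLinearMap ∘ₗ
      (Coalgebra.counit (R := k) (A := H)).lTensor B ∘ₗ coact.toLinearMap = LinearMap.id

/-- The relations `(b a) ⊗ b' - b ⊗ (a b')`, `a ∈ A`, in `B ⊗[k] B`. -/
def balancedRelations {k : Type v} {B : Type u} [CommRing k] [Ring B] [Algebra k B]
    (A : Subalgebra k B) : Submodule k (B ⊗[k] B) :=
  Submodule.span k {z | ∃ b b' : B, ∃ a ∈ A, z = (b * a) ⊗ₜ[k] b' - b ⊗ₜ[k] (a * b')}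

/-- The tensor product `B ⊗_A B` over a (not necessarily commutative) subalgebra `A` of `B`,
as the quotient of `B ⊗[k] B` by the balancing relations. -/
abbrev BalancedTensor {k : Type v} {B : Type u} [CommRing k] [Ring B] [Algebra k B]
    (A : Subalgebra k B) : Type u := (B ⊗[k] B) ⧸ balancedRelations A

namespace RightComoduleAlgebra

variable {k : Type v} {H : Type w} {B : Type u} [CommRing k] [Ring H] [HopfAlgebra k H]
  [Ring B] [Algebra k B] (ρ : RightComoduleAlgebra k H B)

/-- The coinvariants `A = {a | ρ(a) = a ⊗ 1}`. -/
def coinvariants : Subalgebra k B :=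
  AlgHom.equalizer ρ.coact (Algebra.TensorProduct.includeLeft : B →ₐ[k] B ⊗[k] H)

theorem mem_coinvariants {a : B} : a ∈ ρ.coinvariants ↔ ρ.coact a = a ⊗ₜ[k] (1 : H) :=
  Iff.rfl

/-- The canonical map `B ⊗_A B → B ⊗ H`, `b ⊗ b' ↦ (b ⊗ 1) ρ(b')`. -/
def leftCan : BalancedTensor ρ.coinvariants →ₗ[k] B ⊗[k] H :=
  (balancedRelations ρ.coinvariants).liftQ
    (LinearMap.mul' k (B ⊗[k] H) ∘ₗ TensorProduct.map
      (Algebra.TensorProduct.includeLeft : B →ₐ[k] B ⊗[k] H).toLinearMap ρ.coact.toLinearMap)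
    (by
      rw [balancedRelations, Submodule.span_le]
      rintro _ ⟨b, b', a, ha, rfl⟩
      have ha' := ρ.mem_coinvariants.1 ha
      simp [ha', ← mul_assoc])

theorem leftCan_mk_tmul (b b' : B) :
    ρ.leftCan (Submodule.Quotient.mk (b ⊗ₜ[k] b')) = (b ⊗ₜ[k] (1 : H)) * ρ.coact b' := by
  simp [leftCan]

/-- The canonical map `B ⊗_A B → B ⊗ H`, `b ⊗ b' ↦ ρ(b) (b' ⊗ 1)`. -/
def rightCan : BalancedTensor ρ.coinvariants →ₗ[k] B ⊗[k] H :=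
  (balancedRelations ρ.coinvariants).liftQ
    (LinearMap.mul' k (B ⊗[k] H) ∘ₗ TensorProduct.map ρ.coact.toLinearMap
      (Algebra.TensorProduct.includeLeft : B →ₐ[k] B ⊗[k] H).toLinearMap)
    (by
      rw [balancedRelations, Submodule.span_le]
      rintro _ ⟨b, b', a, ha, rfl⟩
      have ha' := ρ.mem_coinvariants.1 ha
      simp [ha', mul_assoc])

theorem rightCan_mk_tmul (b b' : B) :
    ρ.rightCan (Submodule.Quotient.mk (b ⊗ₜ[k] b')) = ρ.coact b * (b' ⊗ₜ[k] (1 : H)) := by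
  simp [rightCan]

/-- `B / B^{co H}` is `H`-Galois if one of the two canonical maps is bijective. -/
def IsHopfGalois : Prop :=
  Function.Bijective ρ.leftCan ∨ Function.Bijective ρ.rightCan

end RightComoduleAlgebra

end

/-! In Sweedler notation, a left integral `Λ` and a left cointegral `l` with `l(Λ) = 1` give a trace
`tr(b) = b₀ l(b₁)` from `B` to `A`. The Galois condition gives finitely many pairs `x, y` in `B`
with `∑ ρ(x)(y ⊗ 1) = 1 ⊗ Λ`. Then `∑ tr(b x) y = b₀ l(b₁ Λ) = b`, so the maps `tr(· x)` and the
elements `y` are dual bases of `B` over `A`.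

If `f`, `p` are dual bases of `P` over `B`, then the maps `tr(f(·) x)` and the elements `y p` are
dual bases over `A`. With `b = ∑ f(p)`, the rank over `A` is therefore `∑ tr(y b x)`. Modulo `[B,
B]` the factor `y₀` moves to the end, leaving `b₀ x₀ y₀ l(y₁ b₁ x₁)`. Now `∑ x₀ y₀ ⊗ y₁ ⊗ x₁ = 1 ⊗
S(Λ₁) ⊗ Λ₂` (`sum_coact_mul_coact`) and `l(S(Λ₁) h Λ₂) = ε(Λ) l(h)` (`cointegral_antipode_mul_mul`)
turn this into `ε(Λ) tr(b)`, an element of `(𝔡H)A`.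

The pair `Λ, l` comes from `exists_integral_cointegral`: the Frobenius isomorphism yields `Λ`, and a
trace over `H` yields `l`, where `S² = id` makes the trace compatible with coactions. -/

noncomputable section

/-! ### Contraction of tensors by linear forms -/

section Contraction

variable {k : Type*} {H M : Type*} [CommRing k] [AddCommGroup H] [Module k H]
  [AddCommGroup M] [Module k M]

/-- Contraction of the right tensor factor with a linear form: `m ⊗ h ↦ g h • m`. -/
def contractTensorRight (M : Type*) [AddCommGroup M] [Module k M] (g : H →ₗ[k] k) :
    M ⊗[k] H →ₗ[k] M :=
  (TensorProduct.rid k M).toLinearMap ∘ₗ g.lTensor M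

@[simp]
theorem contractTensorRight_tmul (g : H →ₗ[k] k) (m : M) (h : H) :
    contractTensorRight M g (m ⊗ₜ[k] h) = g h • m := by
  simp [contractTensorRight]

end Contraction

/-! ### Antipode identities and integrals -/

section Hopf

variable {k : Type v} {H : Type w} [CommRing k] [Ring H] [HopfAlgebra k H]

open Coalgebra HopfAlgebra

/-- A coassociative coaction commutes with slicing its right factor by a linear form. -/
theorem coact_contractTensorRight {M : Type*} [AddCommGroup M] [Module k M]
    (δ : M →ₗ[k] M ⊗[k] H)
    (hδ : (TensorProduct.assoc k M H H).toLinearMap ∘ₗ δ.rTensor H ∘ₗ δ =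
      (comul (R := k) (A := H)).lTensor M ∘ₗ δ)
    (g : H →ₗ[k] k) (m : M) :
    δ (contractTensorRight M g (δ m)) =
      (contractTensorRight H g ∘ₗ comul).lTensor M (δ m) := by
  have key : ∀ t : M ⊗[k] H, δ (contractTensorRight M g t) =
      (contractTensorRight H g).lTensor M (TensorProduct.assoc k M H H (δ.rTensor H t)) := by
    intro t
    induction t with
    | zero => simp
    | add x y hx hy => simp only [map_add, hx, hy]
    | tmul p q =>
      simp only [contractTensorRight_tmul, map_smul, LinearMap.rTensor_tmul]
      induction δ p with
      | zero => simp
      | add x y hx hy => simp only [smul_add, TensorProduct.add_tmul, map_add, hx, hy]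
      | tmul a b => simp
  rw [key, LinearMap.lTensor_comp_apply]
  exact congrArg _ (LinearMap.congr_fun hδ m)

/-- The map `a ⊗ b ↦ m (a ⊗ b₁) ⊗ b₂`. -/
def leftContractComul (m : H ⊗[k] H →ₗ[k] H) : H ⊗[k] H →ₗ[k] H ⊗[k] H :=
  m.rTensor H ∘ₗ (TensorProduct.assoc k H H H).symm.toLinearMap ∘ₗ comul.lTensor H

/-- Coassociativity and the counit: `m(h₁ ⊗ h₂) ⊗ h₃ = ε(h₁) 1 ⊗ h₂`. It is used for both `S(h₁)h₂`
and `S(h₂)h₁`. -/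
theorem leftContractComul_comul {m : H ⊗[k] H →ₗ[k] H}
    (hm : ∀ h : H, m (comul h) = algebraMap k H (counit h)) (h : H) :
    leftContractComul m (comul h) = 1 ⊗ₜ[k] h := by
  have hm' : m ∘ₗ comul = Algebra.linearMap k H ∘ₗ counit := LinearMap.ext hm
  simp only [leftContractComul, LinearMap.comp_apply, LinearEquiv.coe_coe, coassoc_symm_apply]
  rw [← LinearMap.rTensor_comp_apply, hm', LinearMap.rTensor_comp_apply, rTensor_counit_comul]
  simp

/-- The map `a ⊗ b ↦ S(a) b`. -/
def antipodeMul (k : Type v) (H : Type w) [CommRing k] [Ring H] [HopfAlgebra k H] :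
    H ⊗[k] H →ₗ[k] H :=
  LinearMap.mul' k H ∘ₗ (antipode k).rTensor H

/-- The map `a ⊗ b ↦ S(b) a`. -/
def antipodeMulSwap (k : Type v) (H : Type w) [CommRing k] [Ring H] [HopfAlgebra k H] :
    H ⊗[k] H →ₗ[k] H :=
  antipodeMul k H ∘ₗ (TensorProduct.comm k H H).toLinearMap

@[simp]
theorem antipodeMul_tmul (a b : H) : antipodeMul k H (a ⊗ₜ b) = antipode k a * b := by
  simp [antipodeMul]

@[simp]
theorem antipodeMulSwap_tmul (a b : H) : antipodeMulSwap k H (a ⊗ₜ b) = antipode k b * a := by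
  simp [antipodeMulSwap]

theorem antipodeMul_comul (h : H) :
    antipodeMul k H (comul h) = algebraMap k H (counit h) := by
  simp [antipodeMul]

/-- As `S` reverses products and `S² = id`, applying `S` to `S(h₂)h₁` gives `S(h₁)h₂ = ε(h)`; a
second application of `S` recovers the original element. -/
theorem IsInvolutory.antipodeMulSwap_comul (hS : IsInvolutory k H) (h : H) :
    antipodeMulSwap k H (comul h) = algebraMap k H (counit h) := by
  have key : ∀ t : H ⊗[k] H, antipode k (antipodeMulSwap k H t) = antipodeMul k H t := by
    intro t
    induction t with
    | zero => simp
    | add x y hx hy => simp only [map_add, hx, hy]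
    | tmul a b => simp [antipode_mul_antidistrib, hS b]
  rw [← hS (antipodeMulSwap k H (comul h)), key, antipodeMul_comul,
    Algebra.algebraMap_eq_smul_one, map_smul, antipode_one]

theorem leftContractComul_antipodeMul_tmul (a b : H) :
    leftContractComul (antipodeMul k H) (a ⊗ₜ b) = (antipode k a ⊗ₜ[k] (1 : H)) * comul b := by
  simp only [leftContractComul, LinearMap.comp_apply, LinearMap.lTensor_tmul, LinearEquiv.coe_coe]
  induction comul (R := k) b with
  | zero => simp
  | add x y hx hy => simp only [TensorProduct.tmul_add, map_add, hx, hy, mul_add]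
  | tmul p q => simp

theorem leftContractComul_antipodeMulSwap_tmul (a b : H) :
    leftContractComul (antipodeMulSwap k H) (a ⊗ₜ b) =
      (antipode k).rTensor H (comul b) * (a ⊗ₜ[k] (1 : H)) := by
  simp only [leftContractComul, LinearMap.comp_apply, LinearMap.lTensor_tmul, LinearEquiv.coe_coe]
  induction comul (R := k) b with
  | zero => simp
  | add x y hx hy => simp only [TensorProduct.tmul_add, map_add, hx, hy, add_mul]
  | tmul p q => simp

/-- `S(h) Λ₁ ⊗ Λ₂ = Λ₁ ⊗ h Λ₂` for a left integral `Λ`. -/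
theorem antipode_tmul_one_mul_comul_of_mem_leftIntegrals {Λ : H} (hΛ : Λ ∈ leftIntegrals k H)
    (h : H) : (antipode k h ⊗ₜ[k] (1 : H)) * comul Λ = ((1 : H) ⊗ₜ[k] h) * comul Λ := by
  -- Write `1 ⊗ h` as `S(h₁)h₂ ⊗ h₃`; then `Δ(h₂)Δ(Λ) = ε(h₂)Δ(Λ)` leaves only `S(h)`.
  rw [← leftContractComul_comul (antipodeMul_comul (k := k)) h]
  have key : ∀ t : H ⊗[k] H, leftContractComul (antipodeMul k H) t * comul Λ =
      (antipode k (contractTensorRight H counit t) ⊗ₜ[k] (1 : H)) * comul Λ := by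
    intro t
    induction t with
    | zero => simp
    | add x y hx hy => simp only [map_add, add_mul, hx, hy, TensorProduct.add_tmul]
    | tmul a b =>
      rw [leftContractComul_antipodeMul_tmul, mul_assoc, ← Bialgebra.comul_mul, hΛ b, map_smul,
        mul_smul_comm, contractTensorRight_tmul, map_smul, ← TensorProduct.smul_tmul',
        smul_mul_assoc]
  rw [key]
  simp [contractTensorRight]

/-- The left integrals of the dual algebra: `h₁ λ(h₂) = λ(h) 1`. -/
def IsLeftCointegral (l : Module.Dual k H) : Prop :=
  ∀ h : H, contractTensorRight H l (comul h) = algebraMap k H (l h)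

/-! ### Traces of endomorphisms of `H` and construction of the cointegral -/

variable {ι : Type*} [Fintype ι] {f : ι → H →ₗ[k] k} {p : ι → H}

/-- Colinearity of the trace for the coaction of `H` on its endomorphisms. Expanding the second leg
of `Δ(pᵢ)` in the basis and summing over `i` leaves, with `w = W(pⱼ)`, the terms `S(w₂) w₁ fⱼ(w₃)`.
These equal `fⱼ(w)` because `S(h₂)h₁ = ε(h)`. -/
theorem IsInvolutory.sum_contract_eq_trace (hS : IsInvolutory k H) (hfp : IsDualBases f p)
    (W : H →ₗ[k] H) :
    ∑ i, contractTensorRight H (f i)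
        ((LinearMap.mul' k (H ⊗[k] H) ∘ₗ TensorProduct.map
          ((Algebra.TensorProduct.includeLeft : H →ₐ[k] H ⊗[k] H).toLinearMap ∘ₗ antipode k)
          (comul ∘ₗ W)) (comul (p i))) =
      algebraMap k H (∑ i, f i (W (p i))) := by
  have expand : ∀ (i : ι) (t : H ⊗[k] H), contractTensorRight H (f i)
      ((LinearMap.mul' k (H ⊗[k] H) ∘ₗ TensorProduct.map
          ((Algebra.TensorProduct.includeLeft : H →ₐ[k] H ⊗[k] H).toLinearMap ∘ₗ antipode k)
          (comul ∘ₗ W)) t) =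
      ∑ j, antipode k (contractTensorRight H (f j) t) *
        contractTensorRight H (f i) (comul (W (p j))) := by
    intro i t
    induction t with
    | zero => simp
    | add x y hx hy => simp only [map_add, hx, hy, add_mul, Finset.sum_add_distrib]
    | tmul a b =>
      have hmul : ∀ s : H ⊗[k] H, contractTensorRight H (f i) ((antipode k a ⊗ₜ[k] (1 : H)) * s)
          = antipode k a * contractTensorRight H (f i) s := by
        intro s
        induction s with
        | zero => simp
        | add x y hx hy => simp only [map_add, mul_add, hx, hy]
        | tmul c d => simp
      simp only [LinearMap.comp_apply, TensorProduct.map_tmul, LinearMap.mul'_apply,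
        AlgHom.toLinearMap_apply, Algebra.TensorProduct.includeLeft_apply,
        contractTensorRight_tmul, map_smul, smul_mul_assoc]
      conv_lhs => rw [hfp b]
      simp [hmul, Finset.mul_sum]
  simp only [expand]
  rw [Finset.sum_comm, map_sum]
  refine Finset.sum_congr rfl fun j _ => ?_
  have collapse : ∀ t : H ⊗[k] H, ∑ i, antipode k (contractTensorRight H (f j) (comul (p i))) *
      contractTensorRight H (f i) t =
      contractTensorRight H (f j) (leftContractComul (antipodeMulSwap k H) t) := by
    intro t
    induction t with
    | zero => simp
    | add x y hx hy => simp only [map_add, hx, hy, mul_add, Finset.sum_add_distrib]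
    | tmul a b =>
      have hswap : ∀ s : H ⊗[k] H, contractTensorRight H (f j)
          ((antipode k).rTensor H s * (a ⊗ₜ[k] (1 : H))) =
          antipode k (contractTensorRight H (f j) s) * a := by
        intro s
        induction s with
        | zero => simp
        | add x y hx hy => simp only [map_add, add_mul, hx, hy]
        | tmul c d => simp
      rw [leftContractComul_antipodeMulSwap_tmul, hswap]
      conv_rhs => rw [hfp b]
      simp [Finset.sum_mul]
  rw [collapse, leftContractComul_comul hS.antipodeMulSwap_comul]
  simp [Algebra.algebraMap_eq_smul_one]

/-- The form `x ↦ Tr (y ↦ (y x)₁ φ((y x)₂))`. -/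
def traceForm (f : ι → H →ₗ[k] k) (p : ι → H) (φ : H →ₗ[k] k) : Module.Dual k H :=
  ∑ i, f i ∘ₗ contractTensorRight H φ ∘ₗ comul ∘ₗ LinearMap.mulLeft k (p i)

theorem traceForm_apply (φ : H →ₗ[k] k) (x : H) :
    traceForm f p φ x = ∑ i, f i (contractTensorRight H φ (comul (p i * x))) := by
  simp [traceForm]

/-- Colinearity of the trace is applied to `W(y) = T(yx)` with `T(z) = z₁ φ(z₂)`. Since `Δ ∘ T = (id
⊗ T) ∘ Δ`, the expression inside the trace collapses through `S(y₁)y₂ x₁ ⊗ T(y₃ x₂) = x₁ ⊗ T(y x₂)`.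
-/
theorem IsInvolutory.isLeftCointegral_traceForm (hS : IsInvolutory k H) (hfp : IsDualBases f p)
    (φ : H →ₗ[k] k) : IsLeftCointegral (traceForm f p φ) := by
  intro x
  set T : H →ₗ[k] H := contractTensorRight H φ ∘ₗ comul with hT
  have hΔT : ∀ z, comul (R := k) (T z) = T.lTensor H (comul z) := fun z =>
    coact_contractTensorRight (comul (R := k) (A := H)) (coassoc (R := k) (A := H)) φ z
  have hlin : ∀ (c : H) (z : H ⊗[k] H), (c ⊗ₜ[k] (1 : H)) * T.lTensor H z =
      T.lTensor H ((c ⊗ₜ[k] (1 : H)) * z) := by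
    intro c z
    induction z with
    | zero => simp
    | add x y hx hy => simp only [map_add, mul_add, hx, hy]
    | tmul c d => simp
  have key : ∀ t : H ⊗[k] H, (LinearMap.mul' k (H ⊗[k] H) ∘ₗ TensorProduct.map
          ((Algebra.TensorProduct.includeLeft : H →ₐ[k] H ⊗[k] H).toLinearMap ∘ₗ antipode k)
          (comul ∘ₗ T ∘ₗ LinearMap.mulRight k x)) t =
        T.lTensor H (leftContractComul (antipodeMul k H) t * comul x) := by
    intro t
    induction t with
    | zero => simp
    | add x y hx hy => simp only [map_add, add_mul, hx, hy]
    | tmul a b =>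
      simp only [LinearMap.comp_apply, TensorProduct.map_tmul, LinearMap.mul'_apply,
        AlgHom.toLinearMap_apply, Algebra.TensorProduct.includeLeft_apply,
        LinearMap.mulRight_apply, hΔT, hlin, leftContractComul_antipodeMul_tmul,
        Bialgebra.comul_mul, mul_assoc]
  have hsum := hS.sum_contract_eq_trace hfp (T ∘ₗ LinearMap.mulRight k x)
  simp only [key, leftContractComul_comul (antipodeMul_comul (k := k))] at hsum
  rw [traceForm_apply]
  refine Eq.trans ?_ hsum
  induction comul (R := k) x with
  | zero => simp
  | add x y hx hy => simp only [map_add, mul_add, hx, hy, Finset.sum_add_distrib]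
  | tmul c d => simp [traceForm_apply, hT, Finset.sum_smul]

/-- An involutory Frobenius Hopf algebra has a left integral and a left cointegral which pair
to `1`. -/
theorem IsInvolutory.exists_integral_cointegral (hS : IsInvolutory k H)
    (hF : IsFrobeniusAlgebra k H) :
    ∃ Λ ∈ leftIntegrals k H, ∃ l : Module.Dual k H, IsLeftCointegral l ∧ l Λ = 1 := by
  obtain ⟨_, _, e, he⟩ := hF
  obtain ⟨n, f, p, hfp⟩ := exists_isDualBases k H
  -- The Frobenius isomorphism sends `bΛ` to `x ↦ ε(xb) = ε(b)ε(x)` when it sends `Λ` to `ε`.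
  have hint : e.symm counit ∈ leftIntegrals k H := by
    intro b
    apply e.injective
    ext x
    rw [he, map_smul, e.apply_symm_apply]
    simp [mul_comm]
  have hφ : e 1 (e.symm counit) = 1 := by
    have := he (e.symm counit) 1 1
    simpa using this.symm
  refine ⟨_, hint, traceForm f p (e 1), hS.isLeftCointegral_traceForm hfp _, ?_⟩
  rw [traceForm_apply]
  -- With `φ = e 1`, the map `y ↦ (yΛ)₁ φ((yΛ)₂)` is the rank-one map `y ↦ ε(y) u`, so its trace is
  -- `ε(u) = φ(Λ) = 1`.
  set u := contractTensorRight H (e 1) (comul (e.symm counit)) with hu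
  have h1 : counit (R := k) u = 1 := by
    have : ∀ t : H ⊗[k] H, counit (R := k) (contractTensorRight H (e 1) t) =
        e 1 (TensorProduct.lid k H (counit.rTensor H t)) := by
      intro t
      induction t with
      | zero => simp
      | add x y hx hy => simp only [map_add, hx, hy]
      | tmul c d => simp [mul_comm]
    rw [hu, this]
    simp [hφ]
  have h2 := congrArg (counit (R := k)) (hfp u)
  rw [h1] at h2
  rw [h2, map_sum]
  refine Finset.sum_congr rfl fun i _ => ?_
  rw [hint (p i)]
  simp [hu, mul_comm]

/-! ### Dual bases of `H` from an integral and a cointegral -/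

section Pair

variable {Λ : H} {l : Module.Dual k H}

/-- Moving `x` to the first leg turns `Λ₁ l(xΛ₂)` into `S(x) Λ₁ l(Λ₂) = S(x) l(Λ)`. After applying
`S`, this makes `S(Λ₁)` and `l(· Λ₂)` dual bases of `H`. -/
theorem contract_mul_comul_eq_antipode (hΛ : Λ ∈ leftIntegrals k H) (hl : IsLeftCointegral l)
    (h1 : l Λ = 1) (x : H) :
    contractTensorRight H l (((1 : H) ⊗ₜ[k] x) * comul Λ) = antipode k x := by
  rw [← antipode_tmul_one_mul_comul_of_mem_leftIntegrals hΛ]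
  have : ∀ t : H ⊗[k] H, contractTensorRight H l ((antipode k x ⊗ₜ[k] (1 : H)) * t) =
      antipode k x * contractTensorRight H l t := by
    intro t
    induction t with
    | zero => simp
    | add x y hx hy => simp only [map_add, mul_add, hx, hy]
    | tmul c d => simp
  rw [this, hl, h1, map_one, mul_one]

/-- `∑ l (S(Λ₁) h Λ₂) = ε(Λ) l(h)`: both sides are the trace of left multiplication by `h`. -/
theorem IsInvolutory.cointegral_antipode_mul_mul (hS : IsInvolutory k H)
    (hF : IsFrobeniusAlgebra k H) (hΛ : Λ ∈ leftIntegrals k H) (hl : IsLeftCointegral l)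
    (h1 : l Λ = 1) (h : H) :
    l (LinearMap.mul' k H (TensorProduct.map (antipode k) (LinearMap.mulLeft k h) (comul Λ))) =
      counit Λ * l h := by
  obtain ⟨_, _, e, -⟩ := hF
  obtain ⟨s, hs⟩ := TensorProduct.exists_finset (comul (R := k) Λ)
  have dual : ∀ x : H, x = ∑ i ∈ s, l (x * i.2) • antipode k i.1 := by
    intro x
    have := congrArg (antipode k) (contract_mul_comul_eq_antipode hΛ hl h1 x)
    rw [hS] at this
    rw [hs] at this
    simpa [Finset.mul_sum] using this.symm
  let L : H →ₗ[k] Module.Dual k H := (LinearMap.mul k H).compr₂ l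
  have hL : ∀ x y, L x y = l (x * y) := fun _ _ => rfl
  -- The map `r` is a left inverse of `L`, hence surjective. Composed with `H ≃ H*` it is a
  -- surjective endomorphism of a finite module, so it is injective and `L` is onto.
  have hLsurj : Function.Surjective L := by
    let r : Module.Dual k H →ₗ[k] H :=
      ∑ i ∈ s, (LinearMap.toSpanSingleton k H (antipode k i.1)) ∘ₗ Module.Dual.eval k H i.2
    have hr : ∀ x, r (L x) = x := fun x => by
      conv_rhs => rw [dual x]
      simp [r, hL]
    have hsurj : Function.Surjective (r ∘ₗ e.toLinearMap) := fun x =>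
      ⟨e.symm (L x), by simp [hr]⟩
    have hinj := OrzechProperty.injective_of_surjective_endomorphism _ hsurj
    intro g
    refine ⟨r g, ?_⟩
    have : (r ∘ₗ e.toLinearMap) (e.symm (L (r g))) = (r ∘ₗ e.toLinearMap) (e.symm g) := by
      simp [hr]
    exact e.symm.injective (hinj this)
  -- The transposed dual bases: every form `l(x ·)` kills the difference of the two sides. By
  -- `hLsurj` these are all the linear forms, and they separate points because `H` is projective.
  have dual' : ∀ y : H, y = ∑ i ∈ s, l (antipode k i.1 * y) • i.2 := by
    intro y
    have hz : ∀ x, L x (y - ∑ i ∈ s, l (antipode k i.1 * y) • i.2) = 0 := by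
      intro x
      rw [map_sub, sub_eq_zero, hL]
      conv_lhs => rw [dual x]
      simp only [hL, Finset.sum_mul, Finset.mul_sum, map_sum, smul_mul_assoc, mul_smul_comm,
        map_smul, smul_eq_mul]
      exact Finset.sum_congr rfl fun _ _ => mul_comm _ _
    obtain ⟨n, f, p, hfp⟩ := exists_isDualBases k H
    rw [← sub_eq_zero, hfp (y - _)]
    refine Finset.sum_eq_zero fun i _ => ?_
    obtain ⟨x, hx⟩ := hLsurj (f i)
    rw [← hx, hz, zero_smul]
  have hε : ∑ i ∈ s, antipode k i.1 * i.2 = algebraMap k H (counit Λ) := by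
    rw [← antipodeMul_comul, hs]
    simp
  have hr : l (h * ∑ i ∈ s, antipode k i.1 * i.2) = counit Λ * l h := by
    rw [hε, Algebra.algebraMap_eq_smul_one]
    simp
  rw [← hr, hs, Finset.mul_sum]
  simp only [map_sum, TensorProduct.map_tmul, LinearMap.mul'_apply, LinearMap.mulLeft_apply]
  -- The traces of `y ↦ hy` in the two dual bases expand into the same double sum.
  have hL1 : ∀ i : H × H, l (antipode k i.1 * (h * i.2)) =
      ∑ j ∈ s, l (antipode k i.1 * (h * antipode k j.1)) * l (i.2 * j.2) := fun i => by
    conv_lhs => rw [dual i.2]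
    simp [Finset.mul_sum, mul_comm]
  have hR1 : ∀ j : H × H, l (h * (antipode k j.1 * j.2)) =
      ∑ i ∈ s, l (antipode k i.1 * (h * antipode k j.1)) * l (i.2 * j.2) := fun j => by
    conv_lhs => rw [← mul_assoc, dual' (h * antipode k j.1)]
    simp [Finset.sum_mul]
  simp only [hL1, hR1]
  exact Finset.sum_comm

end Pair

end Hopf

theorem IsDualBases.finite_projective {R : Type u} {P : Type v} [Ring R] [AddCommGroup P]
    [Module R P] {ι : Type*} [Fintype ι] {f : ι → P →ₗ[R] R} {p : ι → P} (h : IsDualBases f p) :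
    Module.Finite R P ∧ Module.Projective R P := by
  have hsplit : Fintype.linearCombination R p ∘ₗ LinearMap.pi f = LinearMap.id := by
    ext x
    simpa [Fintype.linearCombination_apply] using (h x).symm
  exact ⟨Module.Finite.of_surjective (Fintype.linearCombination R p) fun x =>
    ⟨LinearMap.pi f x, LinearMap.congr_fun hsplit x⟩, Module.Projective.of_split _ _ hsplit⟩

/-! ### The canonical maps of a comodule algebra -/

namespace RightComoduleAlgebra

open Coalgebra HopfAlgebra

variable {k : Type v} {H : Type w} {B : Type u} [CommRing k] [Ring H] [HopfAlgebra k H]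
  [Ring B] [Algebra k B] (ρ : RightComoduleAlgebra k H B)

/-- The map `b ⊗ h ↦ b₀ ⊗ K (b₁ ⊗ h)`. -/
def coactTwist {N : Type*} [AddCommGroup N] [Module k N] (K : H ⊗[k] H →ₗ[k] N) :
    B ⊗[k] H →ₗ[k] B ⊗[k] N :=
  K.lTensor B ∘ₗ (TensorProduct.assoc k B H H).toLinearMap ∘ₗ ρ.coact.toLinearMap.rTensor H

section Twist

variable {N : Type*} [AddCommGroup N] [Module k N] (K : H ⊗[k] H →ₗ[k] N)

theorem coactTwist_tmul (b : B) (h : H) :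
    ρ.coactTwist K (b ⊗ₜ h) =
      (K ∘ₗ (TensorProduct.mk k H H).flip h).lTensor B (ρ.coact b) := by
  simp only [coactTwist, LinearMap.comp_apply, LinearMap.rTensor_tmul, AlgHom.toLinearMap_apply]
  induction ρ.coact b with
  | zero => simp
  | add x y hx hy => simp only [TensorProduct.add_tmul, map_add, hx, hy]
  | tmul p q => simp

theorem coactTwist_coact (b : B) :
    ρ.coactTwist K (ρ.coact b) = (K ∘ₗ comul).lTensor B (ρ.coact b) := by
  rw [LinearMap.lTensor_comp_apply]
  exact congrArg _ (LinearMap.congr_fun ρ.coassoc b)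

end Twist

theorem lTensor_algebraMap_counit_coact (b : B) :
    (Algebra.linearMap k H ∘ₗ Coalgebra.counit).lTensor B (ρ.coact b) = b ⊗ₜ[k] (1 : H) := by
  have h := congrArg (fun x : B => x ⊗ₜ[k] (1 : H)) (LinearMap.congr_fun ρ.counit b)
  simp only [LinearMap.id_apply] at h
  rw [← h]
  simp only [LinearMap.comp_apply, AlgHom.toLinearMap_apply]
  induction ρ.coact b with
  | zero => simp
  | add x y hx hy => simp only [map_add, hx, hy, TensorProduct.add_tmul]
  | tmul p q => simp [Algebra.algebraMap_eq_smul_one, TensorProduct.smul_tmul']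

/-- The map `a ⊗ b ↦ a S(b)`. -/
def mulAntipode (k : Type v) (H : Type w) [CommRing k] [Ring H] [HopfAlgebra k H] :
    H ⊗[k] H →ₗ[k] H :=
  LinearMap.mul' k H ∘ₗ (antipode k).lTensor H

theorem coactTwist_mulAntipode_coact (b : B) :
    ρ.coactTwist (mulAntipode k H) (ρ.coact b) = b ⊗ₜ[k] (1 : H) := by
  rw [coactTwist_coact, ← lTensor_algebraMap_counit_coact]
  congr 2
  ext h
  simp [mulAntipode]

/-- On `b ⊗ c` the twist gives `b₀c₀ ⊗ b₁c₁S(c₂) = b₀c ⊗ b₁`. This makes the two versions of the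
Galois condition comparable. -/
theorem coactTwist_mulAntipode_leftCan (z : BalancedTensor ρ.coinvariants) :
    ρ.coactTwist (mulAntipode k H) (ρ.leftCan z) = ρ.rightCan z := by
  have hmul : ∀ (b : B) (t : B ⊗[k] H), ρ.coactTwist (mulAntipode k H) ((b ⊗ₜ[k] (1 : H)) * t) =
      ρ.coact b * ρ.coactTwist (mulAntipode k H) t := by
    intro b t
    induction t with
    | zero => simp
    | add x y hx hy => simp only [map_add, mul_add, hx, hy]
    | tmul c h =>
      rw [Algebra.TensorProduct.tmul_mul_tmul, one_mul, coactTwist_tmul, coactTwist_tmul, map_mul]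
      induction ρ.coact c with
      | zero => simp
      | add x y hx hy => simp only [map_add, mul_add, hx, hy]
      | tmul p q =>
        induction ρ.coact b with
        | zero => simp
        | add x y hx hy => simp only [map_add, add_mul, hx, hy]
        | tmul p' q' => simp [mulAntipode, mul_assoc]
  obtain ⟨t, rfl⟩ := Submodule.Quotient.mk_surjective _ z
  induction t with
  | zero => simp
  | add x y hx hy => simp only [Submodule.Quotient.mk_add, map_add, hx, hy]
  | tmul b b' =>
    rw [leftCan_mk_tmul, rightCan_mk_tmul, hmul, coactTwist_mulAntipode_coact]

theorem surjective_coactTwist_mulAntipode (hS : IsInvolutory k H) :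
    Function.Surjective (ρ.coactTwist (mulAntipode k H)) := by
  rw [← LinearMap.range_eq_top, eq_top_iff, ← TensorProduct.span_tmul_eq_top, Submodule.span_le]
  rintro _ ⟨b, h, rfl⟩
  -- The preimage is `b₀ ⊗ S(h)b₁`, since `b₁ S(S(h)b₂) = b₁ S(b₂) S²(h)`.
  refine ⟨(LinearMap.mulLeft k (antipode k h)).lTensor B (ρ.coact b), ?_⟩
  have key : ∀ t : B ⊗[k] H, ρ.coactTwist (mulAntipode k H)
      ((LinearMap.mulLeft k (antipode k h)).lTensor B t) =
      ρ.coactTwist (mulAntipode k H) t * ((1 : B) ⊗ₜ[k] h) := by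
    intro t
    induction t with
    | zero => simp
    | add x y hx hy => simp only [map_add, add_mul, hx, hy]
    | tmul c d =>
      rw [LinearMap.lTensor_tmul, coactTwist_tmul, coactTwist_tmul]
      induction ρ.coact c with
      | zero => simp
      | add x y hx hy => simp only [map_add, add_mul, hx, hy]
      | tmul p q => simp [mulAntipode, antipode_mul_antidistrib, hS h, mul_assoc]
  rw [key, coactTwist_mulAntipode_coact]
  simp

theorem IsHopfGalois.surjective_rightCan (hGalois : ρ.IsHopfGalois) (hS : IsInvolutory k H) :
    Function.Surjective ρ.rightCan := by
  rcases hGalois with h | h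
  · have : (ρ.rightCan : BalancedTensor ρ.coinvariants → B ⊗[k] H) =
        ρ.coactTwist (mulAntipode k H) ∘ ρ.leftCan :=
      funext fun z => (ρ.coactTwist_mulAntipode_leftCan z).symm
    rw [this]
    exact (ρ.surjective_coactTwist_mulAntipode hS).comp h.2
  · exact h.2

theorem IsHopfGalois.exists_sum_coact_mul (hGalois : ρ.IsHopfGalois) (hS : IsInvolutory k H)
    (h : H) : ∃ s : Finset (B × B),
      ∑ i ∈ s, ρ.coact i.1 * (i.2 ⊗ₜ[k] (1 : H)) = (1 : B) ⊗ₜ[k] h := by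
  obtain ⟨z, hz⟩ := hGalois.surjective_rightCan ρ hS ((1 : B) ⊗ₜ[k] h)
  obtain ⟨t, rfl⟩ := Submodule.Quotient.mk_surjective _ z
  obtain ⟨s, rfl⟩ := TensorProduct.exists_finset t
  refine ⟨s, ?_⟩
  rw [← hz, ← Submodule.mkQ_apply, map_sum, map_sum]
  exact Finset.sum_congr rfl fun i _ => (ρ.rightCan_mk_tmul i.1 i.2).symm

/-! ### The trace onto the coinvariants -/

variable {l : Module.Dual k H}

/-- By coassociativity `ρ(b₀ l(b₁)) = b₀ ⊗ b₁ l(b₂)`, and the cointegral property makes the second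
leg `l(b₁) 1`. -/
theorem contract_coact_mem_coinvariants (hl : IsLeftCointegral l) (b : B) :
    contractTensorRight B l (ρ.coact b) ∈ ρ.coinvariants := by
  rw [mem_coinvariants]
  refine (coact_contractTensorRight ρ.coact.toLinearMap ρ.coassoc l b).trans ?_
  have hl' : contractTensorRight H l ∘ₗ comul = Algebra.linearMap k H ∘ₗ l := LinearMap.ext hl
  rw [hl']
  simp only [AlgHom.toLinearMap_apply]
  induction ρ.coact b with
  | zero => simp
  | add x y hx hy => simp only [map_add, hx, hy, TensorProduct.add_tmul]
  | tmul p q => simp [Algebra.algebraMap_eq_smul_one, TensorProduct.smul_tmul']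

/-- The trace map `B → A`, `b ↦ b₀ l(b₁)`, defined by a left cointegral `l`. -/
def coinvariantsTrace (hl : IsLeftCointegral l) : B →ₗ[ρ.coinvariants] ρ.coinvariants where
  toFun b := ⟨contractTensorRight B l (ρ.coact b), ρ.contract_coact_mem_coinvariants hl b⟩
  map_add' x y := by
    ext
    simp
  map_smul' a b := by
    ext
    have ha := ρ.mem_coinvariants.1 a.2
    simp only [Subalgebra.smul_def, smul_eq_mul, map_mul, ha, RingHom.id_apply, Subalgebra.coe_mul]
    induction ρ.coact b with
    | zero => simp
    | add x y hx hy => simp only [map_add, mul_add, hx, hy]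
    | tmul p q => simp

theorem coe_coinvariantsTrace (hl : IsLeftCointegral l) (b : B) :
    (ρ.coinvariantsTrace hl b : B) = contractTensorRight B l (ρ.coact b) := rfl

/-! ### Dual bases and ranks over the coinvariants -/

section DualBases

variable {Λ : H} {s : Finset (B × B)}

/-- The sum is the contraction of `ρ(b) ∑ ρ(x)(y ⊗ 1) = ρ(b)(1 ⊗ Λ)` by `l`, that is `b₀ l(b₁Λ) = b₀
ε(b₁) l(Λ)`. -/
theorem eq_sum_coinvariantsTrace_smul (hΛ : Λ ∈ leftIntegrals k H) (hl : IsLeftCointegral l)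
    (h1 : l Λ = 1) (hs : ∑ i ∈ s, ρ.coact i.1 * (i.2 ⊗ₜ[k] (1 : H)) = (1 : B) ⊗ₜ[k] Λ) (b : B) :
    b = ∑ i ∈ s, ρ.coinvariantsTrace hl (b * i.1) • i.2 := by
  have hterm : ∀ i : B × B, ρ.coinvariantsTrace hl (b * i.1) • i.2 =
      contractTensorRight B l (ρ.coact b * (ρ.coact i.1 * (i.2 ⊗ₜ[k] (1 : H)))) := by
    intro i
    rw [Subalgebra.smul_def, smul_eq_mul, coe_coinvariantsTrace, ← mul_assoc, ← map_mul]
    induction ρ.coact (b * i.1) with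
    | zero => simp
    | add x y hx hy => simp only [map_add, add_mul, hx, hy]
    | tmul p q => simp
  simp only [hterm]
  rw [← map_sum, ← Finset.mul_sum, hs]
  have h := LinearMap.congr_fun ρ.counit b
  refine h.symm.trans ?_
  simp only [LinearMap.comp_apply, AlgHom.toLinearMap_apply]
  induction ρ.coact b with
  | zero => simp
  | add x y hx hy => simp only [map_add, add_mul, hx, hy]
  | tmul p q => simp [hΛ q, h1]

/-- Dual bases over the coinvariants of a `B`-module `P` with dual bases `f`, `p` over `B`. -/
theorem isDualBases_coinvariants (hΛ : Λ ∈ leftIntegrals k H) (hl : IsLeftCointegral l)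
    (h1 : l Λ = 1) (hs : ∑ i ∈ s, ρ.coact i.1 * (i.2 ⊗ₜ[k] (1 : H)) = (1 : B) ⊗ₜ[k] Λ)
    {P : Type*} [AddCommGroup P] [Module B P] {ι : Type*} [Fintype ι] {f : ι → P →ₗ[B] B}
    {p : ι → P} (hfp : IsDualBases f p) :
    IsDualBases (R := ρ.coinvariants)
      (fun i : s × ι => ρ.coinvariantsTrace hl ∘ₗ
        ((LinearMap.toSpanSingleton B B i.1.1.1 ∘ₗ f i.2).restrictScalars ρ.coinvariants))
      (fun i => i.1.1.2 • p i.2) := by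
  intro x
  rw [Fintype.sum_prod_type_right]
  conv_lhs => rw [hfp x]
  refine Finset.sum_congr rfl fun j _ => ?_
  conv_lhs => rw [ρ.eq_sum_coinvariantsTrace_smul hΛ hl h1 hs (f j x), Finset.sum_smul,
    ← Finset.sum_coe_sort]
  refine Finset.sum_congr rfl fun i _ => ?_
  simp [Subalgebra.smul_def, mul_smul]

/-- `∑ x₀ y₀ ⊗ y₁ ⊗ x₁ = 1 ⊗ S(Λ₁) ⊗ Λ₂`. -/
theorem sum_coact_mul_coact (hS : IsInvolutory k H)
    (hs : ∑ i ∈ s, ρ.coact i.1 * (i.2 ⊗ₜ[k] (1 : H)) = (1 : B) ⊗ₜ[k] Λ) :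
    ∑ i ∈ s, (TensorProduct.mk k H H 1).lTensor B (ρ.coact i.1) *
        ((TensorProduct.mk k H H).flip 1).lTensor B (ρ.coact i.2) =
      (1 : B) ⊗ₜ[k] (antipode k).rTensor H (comul Λ) := by
  -- Apply `b ⊗ h ↦ b₀ ⊗ S(h₁)b₁ ⊗ h₂` to `hs`. On `ρ(x)` it gives `x₀ ⊗ S(x₂)x₁ ⊗ x₃ = x₀ ⊗ 1 ⊗
  -- x₁`.
  set K : H ⊗[k] H →ₗ[k] H ⊗[k] H := leftContractComul (antipodeMulSwap k H) with hK
  have hmul : ∀ (t : B ⊗[k] H) (y : B), ρ.coactTwist K (t * (y ⊗ₜ[k] (1 : H))) =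
      ρ.coactTwist K t * ((TensorProduct.mk k H H).flip 1).lTensor B (ρ.coact y) := by
    intro t y
    induction t with
    | zero => simp
    | add x y hx hy => simp only [map_add, add_mul, hx, hy]
    | tmul c h =>
      rw [Algebra.TensorProduct.tmul_mul_tmul, mul_one, coactTwist_tmul, coactTwist_tmul, map_mul]
      induction ρ.coact c with
      | zero => simp
      | add x y hx hy => simp only [map_add, add_mul, hx, hy]
      | tmul p q =>
        induction ρ.coact y with
        | zero => simp
        | add x y hx hy => simp only [map_add, mul_add, hx, hy]
        | tmul p' q' => simp [hK, leftContractComul_antipodeMulSwap_tmul, mul_assoc]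
  have hcoact : ∀ x : B, ρ.coactTwist K (ρ.coact x) =
      (TensorProduct.mk k H H 1).lTensor B (ρ.coact x) := by
    intro x
    rw [coactTwist_coact]
    congr 2
    exact LinearMap.ext fun h => leftContractComul_comul hS.antipodeMulSwap_comul h
  have := congrArg (ρ.coactTwist K) hs
  simp only [map_sum, hmul, hcoact] at this
  rw [this, coactTwist_tmul, map_one, Algebra.TensorProduct.one_def, LinearMap.lTensor_tmul,
    LinearMap.comp_apply, LinearMap.flip_apply, TensorProduct.mk_apply, hK,
    leftContractComul_antipodeMulSwap_tmul, ← Algebra.TensorProduct.one_def, mul_one]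

/-- `∑ tr(y b x) ≡ ε(Λ) tr(b)` modulo commutators. -/
theorem sum_mk_contract_coact (hS : IsInvolutory k H) (hF : IsFrobeniusAlgebra k H)
    (hΛ : Λ ∈ leftIntegrals k H) (hl : IsLeftCointegral l) (h1 : l Λ = 1)
    (hs : ∑ i ∈ s, ρ.coact i.1 * (i.2 ⊗ₜ[k] (1 : H)) = (1 : B) ⊗ₜ[k] Λ) (b : B) :
    ∑ i ∈ s, TraceGroup.mk B (contractTensorRight B l (ρ.coact (i.2 * b * i.1))) =
      TraceGroup.mk B (Coalgebra.counit (R := k) Λ • contractTensorRight B l (ρ.coact b)) := by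
  simp only [map_mul]
  induction ρ.coact b with
  | zero => simp
  | add x y hx hy =>
    simp only [map_add, mul_add, add_mul, Finset.sum_add_distrib, smul_add, hx, hy]
  | tmul c h =>
    let V : H ⊗[k] H →ₗ[k] k :=
      l ∘ₗ LinearMap.mul' k H ∘ₗ (LinearMap.mulLeft k h).lTensor H
    have hterm : ∀ r t : B ⊗[k] H, TraceGroup.mk B (contractTensorRight B l (t * (c ⊗ₜ h) * r)) =
        TraceGroup.mk B (c * contractTensorRight B V ((TensorProduct.mk k H H 1).lTensor B r *
          ((TensorProduct.mk k H H).flip 1).lTensor B t)) := by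
      intro r t
      induction r with
      | zero => simp
      | add x y hx hy => simp only [map_add, add_mul, mul_add, hx, hy]
      | tmul p q =>
        induction t with
        | zero => simp
        | add x y hx hy => simp only [map_add, add_mul, mul_add, hx, hy]
        | tmul p' q' =>
          -- The only use of commutators in `B`: the factor coming from `y₀` moves behind `b₀ x₀`.
          have := TraceGroup.mk_mul_comm p' (l (q' * (h * q)) • (c * p))
          simpa [V, mul_assoc] using this
    simp only [hterm]
    rw [← map_sum, ← Finset.mul_sum, ← map_sum, ρ.sum_coact_mul_coact hS hs,
      contractTensorRight_tmul, contractTensorRight_tmul]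
    have hV : V ((antipode k).rTensor H (comul Λ)) = Coalgebra.counit Λ * l h := by
      rw [← hS.cointegral_antipode_mul_mul hF hΛ hl h1 h]
      rw [← LinearMap.lTensor_comp_rTensor]
      rfl
    rw [hV]
    simp [mul_smul]

/-- The rank over the coinvariants of a `B`-module with dual bases `f`, `p` over `B`. -/
theorem map_hattoriRank_coinvariants (hS : IsInvolutory k H) (hF : IsFrobeniusAlgebra k H)
    (hΛ : Λ ∈ leftIntegrals k H) (hl : IsLeftCointegral l) (h1 : l Λ = 1)
    (hs : ∑ i ∈ s, ρ.coact i.1 * (i.2 ⊗ₜ[k] (1 : H)) = (1 : B) ⊗ₜ[k] Λ)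
    {P : Type*} [AddCommGroup P] [Module B P] [Module.Finite ρ.coinvariants P]
    [Module.Projective ρ.coinvariants P] {ι : Type*} [Fintype ι] {f : ι → P →ₗ[B] B}
    {p : ι → P} (hfp : IsDualBases f p) :
    TraceGroup.map (ρ.coinvariants.val : ρ.coinvariants →+* B) (hattoriRank ρ.coinvariants P) =
      TraceGroup.mk B (Coalgebra.counit (R := k) Λ •
        (ρ.coinvariantsTrace hl (∑ j, f j (p j)) : B)) := by
  rw [hattoriRank, hattoriTrace_eq (ρ.isDualBases_coinvariants hΛ hl h1 hs hfp), map_sum,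
    ρ.coe_coinvariantsTrace, ← ρ.sum_mk_contract_coact hS hF hΛ hl h1 hs,
    Fintype.sum_prod_type, ← Finset.sum_coe_sort s]
  refine Finset.sum_congr rfl fun i _ => ?_
  simp only [Finset.mul_sum, Finset.sum_mul, map_sum]
  refine Finset.sum_congr rfl fun j _ => ?_
  -- Unfolds the functional over the coinvariants, so that `B`-linearity of `f j` can pull out `y`.
  refine Eq.trans (b := TraceGroup.mk B (contractTensorRight B l
    (ρ.coact (f j (i.1.2 • p j) * i.1.1)))) rfl ?_
  rw [map_smul, smul_eq_mul]

end DualBases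

end RightComoduleAlgebra

/-! ### Reduction to classes of modules -/

theorem K0.induction_on {R : Type u} [Ring R] {motive : K0 R → Prop} (z : K0 R)
    (cls : ∀ P, motive (K0.cls P)) (sub : ∀ x y, motive x → motive y → motive (x - y)) :
    motive z := by
  refine AddLocalization.ind (p := motive) (fun y => ?_) z
  obtain ⟨m, n⟩ := y
  obtain ⟨P, hP⟩ := Quotient.exists_rep m
  obtain ⟨Q, hQ⟩ := Quotient.exists_rep n.1
  have hm : K0.cls P = AddLocalization.mk m 0 := congrArg Algebra.GrothendieckAddGroup.of hP
  have hn : K0.cls Q = AddLocalization.mk n.1 0 := congrArg Algebra.GrothendieckAddGroup.of hQ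
  have h := sub _ _ (cls P) (cls Q)
  rw [hm, hn, Algebra.GrothendieckAddGroup.mk_sub_mk] at h
  simpa using h

end

theorem proposition3p6 {k : Type v} {H : Type w} {B : Type u} [CommRing k] [Ring H]
    [HopfAlgebra k H] [Ring B] [Algebra k B] (ρ : RightComoduleAlgebra k H B)
    (hGalois : ρ.IsHopfGalois) (hInv : IsInvolutory k H) (hFrob : IsFrobeniusAlgebra k H) :
    ∃ (_ : Module.Finite ρ.coinvariants B) (_ : Module.Projective ρ.coinvariants B),
      ((TraceGroup.map (ρ.coinvariants.val : ρ.coinvariants →+* B)).comp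
          ((K0.rank ρ.coinvariants).comp (K0.res ρ.coinvariants))).range ≤
        AddSubgroup.map (TraceGroup.mk B)
          (integralIdeal k H • Subalgebra.toSubmodule ρ.coinvariants).toAddSubgroup := by
  obtain ⟨Λ, hΛ, l, hl, h1⟩ := hInv.exists_integral_cointegral hFrob
  obtain ⟨s, hs⟩ := hGalois.exists_sum_coact_mul ρ hInv Λ
  -- Taking `P = B` with the basis `1` yields finiteness and projectivity of `B` over the
  -- coinvariants.
  have hB : IsDualBases (fun _ : Unit => (LinearMap.id : B →ₗ[B] B)) (fun _ => 1) := fun x => by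
    simp
  obtain ⟨hfin, hproj⟩ := (ρ.isDualBases_coinvariants hΛ hl h1 hs hB).finite_projective
  refine ⟨hfin, hproj, ?_⟩
  rintro _ ⟨z, rfl⟩
  induction z using K0.induction_on with
  | sub x y hx hy =>
    rw [map_sub]
    exact AddSubgroup.sub_mem _ hx hy
  | cls P =>
    obtain ⟨n, f, p, hfp⟩ := exists_isDualBases B P.carrier
    simp only [AddMonoidHom.comp_apply, K0.res_cls, K0.rank_cls]
    have := (finite_projective_restrict ρ.coinvariants P.carrier).1
    have := (finite_projective_restrict ρ.coinvariants P.carrier).2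
    exact ⟨Coalgebra.counit (R := k) Λ • (ρ.coinvariantsTrace hl (∑ j, f j (p j)) : B),
      Submodule.smul_mem_smul ⟨Λ, hΛ, rfl⟩ (ρ.coinvariantsTrace hl _).2,
      (ρ.map_hattoriRank_coinvariants hInv hFrob hΛ hl h1 hs hfp).symm⟩
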